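/- Let $G$ be a locally compact Hausdorff topological group, $X$ a locally compact Hausdorff space with a continuous action of $G$, and $V$ a continuous $G$-module, that is, a Hausdorff locally convex real topological vector space with a (jointly) continuous action of $G$ by additive automorphisms (these are automatically linear). For a locally compact Hausdorff $G$-space $Y$, let $C(Y,V)$ be the space of continuous maps with the compact-open topology and the $G$-action $(\alpha\cdot f)(y)=\alpha\cdot f(\alpha^{-1}y)$; it is a continuous $G$-module. For a topological abelian group $M$ with a continuous action of $G$ by automorphisms, let $H^r(G,M)$ be the continuous cohomology of $G$, i.e. the cohomology of the complex of continuous inhomogeneous cochains $C^r(G;M)=C(G^r,M)$ with $$(\partial^r\lambda)(\alpha_1,\dots,\alpha_{r+1})=\alpha_1\cdot\lambda(\alpha_2,\dots,\alpha_{r+1})+\sum_{i=1}^{r}(-1)^i\lambda(\alpha_1,\dots,\alpha_i\alpha_{i+1},\dots,\alpha_{r+1})+(-1)^{r+1}\lambda(\alpha_1,\dots,\alpha_r).$$ Let $\pi:X\to X/G$ be the projection to the orbit space with the quotient topology. (1) Suppose that $X/G$ is a paracompact Hausdorff space and that every point $p\in X/G$ has an open neighbourhood $W$ such that $H^r(G,C(\pi^{-1}(U),V))=0$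 for all $r\ge 1$ and all open $U$ with $p\in U\subseteq W$ (local vanishing of the continuous cohomology of $G$ with coefficients $\pi_*\mathcal C_{X,V}$). Then $H^r(G,C(X,V))=0$ for all $r\ge 1$. (2) Suppose that $G$ is a (finite-dimensional, real) Lie group, that $X$ is a smooth (finite-dimensional, Hausdorff, paracompact) manifold without boundary on which $G$ acts smoothly and properly, and that $V$ is quasi-complete, i.e. every closed bounded subset of $V$ is complete. Then $H^r(G,C(X,V))=0$ for all $r\ge 1$. -/

import Mathlib

open scoped Manifold ContDiff

/-! ### Continuous cohomology of a topological group with coefficients in a continuous module -/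

namespace ContCohomology

section Cochains

variable (G M : Type*) [Group G] [TopologicalSpace G] [IsTopologicalGroup G]
  [AddCommGroup M] [TopologicalSpace M] [IsTopologicalAddGroup M]
  [DistribMulAction G M] [ContinuousSMul G M]

/-- The group `C(Gʳ, M)` of continuous inhomogeneous `r`-cochains. -/
abbrev Cochain (r : ℕ) : Type _ := C(Fin r → G, M)

theorem continuous_contractNth (r : ℕ) (j : Fin (r + 1)) :
    Continuous fun g : Fin (r + 1) → G => Fin.contractNth j (· * ·) g := by
  refine continuous_pi fun k => ?_
  unfold Fin.contractNth
  split_ifs <;> fun_prop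

/-- The inhomogeneous coboundary operator
`(∂ c)(α₁, …, αᵣ₊₁) = α₁ • c(α₂, …, αᵣ₊₁) + ∑_{i=1}^{r} (-1)^i c(α₁, …, αᵢαᵢ₊₁, …, αᵣ₊₁)
  + (-1)^{r+1} c(α₁, …, αᵣ)`.
The index `j : Fin (r + 1)` stands for `i = j + 1`; for `j = r` the tuple `Fin.contractNth j` is
`(α₁, …, αᵣ)`, which is the last term. -/
def coboundary (r : ℕ) : Cochain G M r →+ Cochain G M (r + 1) where
  toFun c :=
    { toFun := fun α => α 0 • c (fun i => α i.succ) +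
        ∑ j : Fin (r + 1), (-1 : ℤ) ^ ((j : ℕ) + 1) • c (Fin.contractNth j (· * ·) α)
      continuous_toFun := by
        refine Continuous.add (by fun_prop) (continuous_finsetSum _ fun j _ => ?_)
        exact (continuous_zsmul (G := M) _).comp
          (c.continuous.comp (continuous_contractNth G r j)) }
  map_zero' := by ext; simp
  map_add' c c' := by
    ext α
    simp only [ContinuousMap.coe_mk, ContinuousMap.add_apply, smul_add, Finset.sum_add_distrib]
    abel

/-- The group of continuous `r`-cocycles. -/
def cocycles (r : ℕ) : AddSubgroup (Cochain G M r) := (coboundary G M r).ker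

/-- The group of continuous `r`-coboundaries. -/
def coboundaries : (r : ℕ) → AddSubgroup (Cochain G M r)
  | 0 => ⊥
  | r + 1 => (coboundary G M r).range

/-- The continuous cohomology group `Hʳ(G, M) = ker ∂ʳ / im ∂ʳ⁻¹` (and `H⁰(G, M) = ker ∂⁰`). -/
abbrev H (r : ℕ) : Type _ := cocycles G M r ⧸ (coboundaries G M r).addSubgroupOf (cocycles G M r)

end Cochains

/-! ### The `G`-module of continuous maps from a `G`-space to a `G`-module -/

/-- The space `C(X, V)` of continuous maps from a `G`-space `X` to a `G`-module `V`, with the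
compact-open topology. It is a type synonym of `C(X, V)`, because it carries the action
`(α • f)(x) = α • f(α⁻¹ • x)` and not the pointwise one. -/
@[nolint unusedArguments]
def MapModule (_G X V : Type*) [TopologicalSpace X] [TopologicalSpace V] : Type _ := C(X, V)

namespace MapModule

variable {G X V : Type*} [TopologicalSpace X]

instance [TopologicalSpace V] : FunLike (MapModule G X V) X V :=
  inferInstanceAs (FunLike C(X, V) X V)

instance [TopologicalSpace V] : ContinuousMapClass (MapModule G X V) X V :=
  inferInstanceAs (ContinuousMapClass C(X, V) X V)

/-- The compact-open topology. -/
instance [TopologicalSpace V] : TopologicalSpace (MapModule G X V) :=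
  inferInstanceAs (TopologicalSpace C(X, V))

section Group

variable [TopologicalSpace V] [AddCommGroup V] [IsTopologicalAddGroup V]

/-- Pointwise addition. -/
instance : AddCommGroup (MapModule G X V) := inferInstanceAs (AddCommGroup C(X, V))

instance : IsTopologicalAddGroup (MapModule G X V) :=
  inferInstanceAs (IsTopologicalAddGroup C(X, V))

variable [Group G] [TopologicalSpace G] [MulAction G X] [ContinuousSMul G X]
  [DistribMulAction G V] [ContinuousSMul G V]

/-- The action `(α • f)(x) = α • f(α⁻¹ • x)`. -/
instance : DistribMulAction G (MapModule G X V) where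
  smul α f := (⟨fun x => α • f (α⁻¹ • x), by fun_prop⟩ : C(X, V))
  one_smul f := DFunLike.ext (F := C(X, V)) _ _ fun x =>
    show (1 : G) • f ((1 : G)⁻¹ • x) = f x by simp
  mul_smul α β f := DFunLike.ext (F := C(X, V)) _ _ fun x =>
    show (α * β) • f ((α * β)⁻¹ • x) = α • β • f (β⁻¹ • α⁻¹ • x) by simp [mul_smul]
  smul_zero α := DFunLike.ext (F := C(X, V)) _ _ fun _ => smul_zero α
  smul_add α _ _ := DFunLike.ext (F := C(X, V)) _ _ fun _ => smul_add α _ _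

theorem smul_apply (α : G) (f : MapModule G X V) (x : X) : (α • f) x = α • f (α⁻¹ • x) := rfl

/-- Over a locally compact space `X`, the `G`-module `C(X, V)` is a continuous one. -/
instance [IsTopologicalGroup G] [LocallyCompactSpace X] :
    ContinuousSMul G (MapModule G X V) where
  continuous_smul := by
    let F : C((G × C(X, V)) × X, V) :=
      ⟨fun p => p.1.1 • p.1.2 (p.1.1⁻¹ • p.2), by fun_prop⟩
    exact F.curry.continuous

end Group

end MapModule

/-! ### Local vanishing over the orbit space -/

section Orbit

variable {G X : Type*} [Group G] [TopologicalSpace X] [MulAction G X]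

/-- The quotient map `π : X → X/G`; the orbit space `X/G` carries the quotient topology. -/
def orbitMap (G X : Type*) [Group G] [MulAction G X] (x : X) : MulAction.orbitRel.Quotient G X :=
  Quotient.mk _ x

/-- The `G`-invariant open subset `π⁻¹(U)` of `X`, for an open subset `U` of `X/G`. -/
def tube (U : TopologicalSpace.Opens (MulAction.orbitRel.Quotient G X)) : SubMulAction G X where
  carrier := orbitMap G X ⁻¹' U
  smul_mem' g x hx := by
    have h : orbitMap G X (g • x) = orbitMap G X x :=
      Quotient.sound (MulAction.mem_orbit x g)
    simpa only [Set.mem_preimage, h] using hx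

theorem isOpen_tube (U : TopologicalSpace.Opens (MulAction.orbitRel.Quotient G X)) :
    IsOpen ((tube U : SubMulAction G X) : Set X) :=
  U.isOpen.preimage continuous_quotient_mk'

instance (U : TopologicalSpace.Opens (MulAction.orbitRel.Quotient G X)) [TopologicalSpace G]
    [ContinuousSMul G X] : ContinuousSMul G (tube U) where
  continuous_smul := by
    refine Continuous.subtype_mk (f := fun p : G × tube U => p.1 • (p.2 : X)) (by fun_prop) _

instance (U : TopologicalSpace.Opens (MulAction.orbitRel.Quotient G X)) [LocallyCompactSpace X] :
    LocallyCompactSpace (tube U) :=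
  (isOpen_tube U).locallyCompactSpace

end Orbit

/-- The continuous cohomology groups of `G` with coefficients in `π_* C_{X,V}` vanish locally:
every point of `X/G` has an open neighbourhood `W` such that `Hʳ(G, C(π⁻¹(U), V)) = 0`, for all
`r ≥ 1` and all open neighbourhoods `U ⊆ W` of the point. -/
def VanishLocally (G X V : Type*) [Group G] [TopologicalSpace G] [IsTopologicalGroup G]
    [TopologicalSpace X] [LocallyCompactSpace X] [MulAction G X] [ContinuousSMul G X]
    [TopologicalSpace V] [AddCommGroup V] [IsTopologicalAddGroup V]
    [DistribMulAction G V] [ContinuousSMul G V] : Prop :=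
  ∀ p : MulAction.orbitRel.Quotient G X,
    ∃ W : TopologicalSpace.Opens (MulAction.orbitRel.Quotient G X), p ∈ W ∧
      ∀ U : TopologicalSpace.Opens (MulAction.orbitRel.Quotient G X), p ∈ U → U ≤ W →
        ∀ r : ℕ, 1 ≤ r → Subsingleton (H G (MapModule G (tube U) V) r)

end ContCohomology

/-! Part (1): local primitives of a cocycle are glued by a partition of unity on `X/G`.
Multiplication by a function pulled back from `X/G` commutes with the coboundary: the function is
constant on orbits and each group element acts `ℝ`-linearly. If `∂ b_p = c` over `W_p`, then `∂ (∑
ρ_p b_p) = ∑ ρ_p c = c`.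

Part (2) reduces to (1) in two steps. `paracompactSpace_orbit_quotient` shows that `X/G` is
paracompact. `vanishLocally_of_properSMul` gives local vanishing: a compactly supported bump
function on `X` restricts to a cutoff function `f` on each small tube, and `IsCutoff.subsingleton_H`
kills the cohomology there by averaging. A primitive of an `(r+1)`-cocycle `c` is, up to sign, the
average over `β ∈ G` of `c(α₁, …, αᵣ, (α₁⋯αᵣ)⁻¹β)(y)` with weight `f(β⁻¹y)` against Haar measure.
The average is a weak integral in `V`; it exists because closed convex hulls of compact sets are
compact in a quasi-complete space. -/

set_option linter.unusedSectionVars false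

namespace ContCohomology

open Topology Set

section Cochains

variable {G M : Type*} [Group G] [TopologicalSpace G] [IsTopologicalGroup G]
  [AddCommGroup M] [TopologicalSpace M] [IsTopologicalAddGroup M]
  [DistribMulAction G M] [ContinuousSMul G M]

theorem coboundary_apply (r : ℕ) (c : Cochain G M r) (α : Fin (r + 1) → G) :
    coboundary G M r c α = α 0 • c (fun i => α i.succ) +
      ∑ j : Fin (r + 1), (-1 : ℤ) ^ ((j : ℕ) + 1) • c (Fin.contractNth j (· * ·) α) := rfl

/-- `Hʳ⁺¹(G, M)` vanishes iff every `(r+1)`-cocycle is a coboundary. -/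
theorem subsingleton_H_succ_iff (r : ℕ) :
    Subsingleton (H G M (r + 1)) ↔
      ∀ c : Cochain G M (r + 1), coboundary G M (r + 1) c = 0 →
        ∃ b : Cochain G M r, coboundary G M r b = c := by
  rw [QuotientAddGroup.subsingleton_iff, AddSubgroup.addSubgroupOf_eq_top]
  exact Iff.rfl

end Cochains

/-! ### Cochains with values in `C(X, V)` as functions on `Gʳ × X`. -/

section MapCochains

variable {G X V : Type*} [Group G] [TopologicalSpace G] [IsTopologicalGroup G]
  [TopologicalSpace X] [LocallyCompactSpace X] [MulAction G X] [ContinuousSMul G X]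
  [TopologicalSpace V] [AddCommGroup V] [IsTopologicalAddGroup V]
  [DistribMulAction G V] [ContinuousSMul G V]

namespace MapModule

theorem zero_apply (x : X) : (0 : MapModule G X V) x = 0 := rfl

/-- Evaluation at a point, as a homomorphism. -/
def evalHom (x : X) : MapModule G X V →+ V where
  toFun f := f x
  map_zero' := rfl
  map_add' _ _ := rfl

theorem evalHom_apply (x : X) (f : MapModule G X V) : evalHom x f = f x := rfl

end MapModule

/-- Cochains with values in `C(X, V)` agree if they agree pointwise. -/
theorem mapCochain_ext {r : ℕ} {c d : Cochain G (MapModule G X V) r}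
    (h : ∀ α x, c α x = d α x) : c = d :=
  ContinuousMap.ext fun α => DFunLike.ext _ _ (h α)

/-- A continuous function on `Gʳ × X` defines a cochain with values in `C(X, V)`. -/
def mkCochain {r : ℕ} (F : (Fin r → G) → X → V)
    (hF : Continuous fun p : (Fin r → G) × X => F p.1 p.2) : Cochain G (MapModule G X V) r :=
  ContinuousMap.curry (⟨fun p : (Fin r → G) × X => F p.1 p.2, hF⟩ : C((Fin r → G) × X, V))

theorem mkCochain_apply {r : ℕ} (F : (Fin r → G) → X → V)
    (hF : Continuous fun p : (Fin r → G) × X => F p.1 p.2) (α : Fin r → G) (x : X) :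
    mkCochain F hF α x = F α x := rfl

/-- A cochain with values in `C(X, V)` is jointly continuous. -/
theorem continuous_uncurry_cochain {r : ℕ} (c : Cochain G (MapModule G X V) r) :
    Continuous fun p : (Fin r → G) × X => c p.1 p.2 :=
  ContinuousMap.continuous_uncurry_of_continuous (f := (c : C(Fin r → G, C(X, V))))

theorem coboundary_map_apply {r : ℕ} (c : Cochain G (MapModule G X V) r)
    (α : Fin (r + 1) → G) (x : X) :
    coboundary G (MapModule G X V) r c α x = α 0 • c (fun i => α i.succ) ((α 0)⁻¹ • x) +
      ∑ j : Fin (r + 1), (-1 : ℤ) ^ ((j : ℕ) + 1) • c (Fin.contractNth j (· * ·) α) x := by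
  have := congrArg (MapModule.evalHom x) (coboundary_apply r c α)
  simpa only [map_add, map_sum, map_zsmul, MapModule.evalHom_apply, MapModule.smul_apply] using this

/-- The coboundary at a point depends only on the values of the cochain on the orbit. -/
theorem coboundary_map_congr {r : ℕ} {c d : Cochain G (MapModule G X V) r} {x : X}
    (h : ∀ α, ∀ g : G, c α (g • x) = d α (g • x)) (α : Fin (r + 1) → G) :
    coboundary G (MapModule G X V) r c α x = coboundary G (MapModule G X V) r d α x := by
  have h1 : ∀ α, c α x = d α x := fun α => by simpa using h α 1
  simp only [coboundary_map_apply, h, h1]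

end MapCochains

theorem orbitMap_smul {G X : Type*} [Group G] [MulAction G X] (g : G) (x : X) :
    orbitMap G X (g • x) = orbitMap G X x :=
  Quotient.sound (MulAction.mem_orbit x g)

/-- A continuous additive map between real topological vector spaces is `ℝ`-linear when the target
is Hausdorff. -/
theorem smul_real_smul {G V : Type*} [Group G] [TopologicalSpace G]
    [TopologicalSpace V] [AddCommGroup V] [Module ℝ V] [ContinuousSMul ℝ V] [T2Space V]
    [DistribMulAction G V] [ContinuousSMul G V] (g : G) (t : ℝ) (v : V) :
    g • t • v = t • g • v :=
  map_real_smul (DistribSMul.toAddMonoidHom V g) (continuous_const_smul g) t v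

/-! ### Gluing local primitives over the orbit space. -/

section Localization

variable {G X V : Type*} [Group G] [TopologicalSpace G] [IsTopologicalGroup G]
  [TopologicalSpace X] [LocallyCompactSpace X] [MulAction G X] [ContinuousSMul G X]
  [TopologicalSpace V] [AddCommGroup V] [IsTopologicalAddGroup V]
  [DistribMulAction G V] [ContinuousSMul G V]

/-- Restriction of cochains to the tube over an open subset of the orbit space. -/
def restrictTube (U : TopologicalSpace.Opens (MulAction.orbitRel.Quotient G X)) {r : ℕ}
    (c : Cochain G (MapModule G X V) r) : Cochain G (MapModule G (tube U) V) r :=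
  mkCochain (fun α x => c α (x : X))
    ((continuous_uncurry_cochain c).comp
      (continuous_fst.prodMk (continuous_subtype_val.comp continuous_snd)))

theorem restrictTube_apply (U : TopologicalSpace.Opens (MulAction.orbitRel.Quotient G X)) {r : ℕ}
    (c : Cochain G (MapModule G X V) r) (α : Fin r → G) (x : tube U) :
    restrictTube U c α x = c α (x : X) := rfl

theorem coboundary_restrictTube (U : TopologicalSpace.Opens (MulAction.orbitRel.Quotient G X))
    {r : ℕ} (c : Cochain G (MapModule G X V) r) :
    coboundary G _ r (restrictTube U c) = restrictTube U (coboundary G _ r c) :=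
  mapCochain_ext fun α x => by
    simp only [coboundary_map_apply, restrictTube_apply, SubMulAction.val_smul]

variable [Module ℝ V] [ContinuousSMul ℝ V] [T2Space V]

open Classical in
/-- The product of a cochain on a tube with a function on the orbit space, extended by zero. -/
noncomputable def extendTube (U : TopologicalSpace.Opens (MulAction.orbitRel.Quotient G X)) {r : ℕ}
    (ρ : C(MulAction.orbitRel.Quotient G X, ℝ)) (b : Cochain G (MapModule G (tube U) V) r)
    (α : Fin r → G) (x : X) : V :=
  if h : x ∈ tube U then ρ (orbitMap G X x) • b α ⟨x, h⟩ else 0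

theorem extendTube_of_mem (U : TopologicalSpace.Opens (MulAction.orbitRel.Quotient G X)) {r : ℕ}
    (ρ : C(MulAction.orbitRel.Quotient G X, ℝ)) (b : Cochain G (MapModule G (tube U) V) r)
    (α : Fin r → G) (x : tube U) :
    extendTube U ρ b α x = ρ (orbitMap G X (x : X)) • b α x :=
  dif_pos x.2

theorem extendTube_of_eq_zero (U : TopologicalSpace.Opens (MulAction.orbitRel.Quotient G X))
    {r : ℕ} (ρ : C(MulAction.orbitRel.Quotient G X, ℝ))
    (b : Cochain G (MapModule G (tube U) V) r) (α : Fin r → G) {x : X}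
    (hx : ρ (orbitMap G X x) = 0) : extendTube U ρ b α x = 0 := by
  unfold extendTube
  split_ifs with h
  · rw [hx, zero_smul]
  · rfl

theorem continuous_orbitMap : Continuous (orbitMap G X) := continuous_quotient_mk'

/-- The tube is open and carries a continuous product; a point outside it has a neighbourhood
missing the closed preimage of `tsupport ρ`, where the extension is zero. -/
theorem continuous_extendTube (U : TopologicalSpace.Opens (MulAction.orbitRel.Quotient G X))
    {r : ℕ} (ρ : C(MulAction.orbitRel.Quotient G X, ℝ))
    (b : Cochain G (MapModule G (tube U) V) r) (hρ : tsupport ρ ⊆ U) :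
    Continuous fun p : (Fin r → G) × X => extendTube U ρ b p.1 p.2 := by
  refine continuous_iff_continuousAt.2 fun p => ?_
  have hπ : Continuous fun p : (Fin r → G) × X => orbitMap G X p.2 :=
    continuous_orbitMap.comp continuous_snd
  by_cases hp : orbitMap G X p.2 ∈ U
  · let e : (Fin r → G) × tube U → (Fin r → G) × X := Prod.map id Subtype.val
    have he : IsOpenEmbedding e :=
      IsOpenEmbedding.id.prodMap (isOpen_tube U).isOpenEmbedding_subtypeVal
    have hc : Continuous ((fun p : (Fin r → G) × X => extendTube U ρ b p.1 p.2) ∘ e) := by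
      have : ((fun p : (Fin r → G) × X => extendTube U ρ b p.1 p.2) ∘ e) =
          fun q : (Fin r → G) × tube U => ρ (orbitMap G X (q.2 : X)) • b q.1 q.2 :=
        funext fun q => extendTube_of_mem U ρ b q.1 q.2
      rw [this]
      exact (ρ.continuous.comp (hπ.comp he.continuous)).smul (continuous_uncurry_cochain b)
    exact he.continuousAt_iff (x := (p.1, (⟨p.2, hp⟩ : tube U))) |>.1 hc.continuousAt
  · have h0 : ∀ᶠ q in 𝓝 p, extendTube U ρ b q.1 q.2 = 0 := by
      have : (fun p : (Fin r → G) × X => orbitMap G X p.2) ⁻¹' (tsupport ρ)ᶜ ∈ 𝓝 p :=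
        ((isClosed_tsupport ρ).isOpen_compl.preimage hπ).mem_nhds fun h => hp (hρ h)
      filter_upwards [this] with q hq
      exact extendTube_of_eq_zero U ρ b q.1 (image_eq_zero_of_notMem_tsupport hq)
    exact (continuousAt_const (y := (0 : V))).congr (h0.mono fun _ h => h.symm)

/-- If `∂ b` is the restriction of `c` to the tube over `U`, then `∂ (ρ b) = ρ c`. -/
theorem coboundary_extendTube (U : TopologicalSpace.Opens (MulAction.orbitRel.Quotient G X))
    {r : ℕ} (ρ : C(MulAction.orbitRel.Quotient G X, ℝ))
    (b : Cochain G (MapModule G (tube U) V) r) (hρ : tsupport ρ ⊆ U)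
    (c : Cochain G (MapModule G X V) (r + 1))
    (hb : coboundary G _ r b = restrictTube U c) (α : Fin (r + 1) → G) (x : X) :
    coboundary G _ r (mkCochain _ (continuous_extendTube U ρ b hρ)) α x =
      ρ (orbitMap G X x) • c α x := by
  rw [coboundary_map_apply]
  simp only [mkCochain_apply]
  by_cases hx : x ∈ tube U
  · have key := coboundary_map_apply b α ⟨x, hx⟩
    rw [hb, restrictTube_apply] at key
    have e1 := extendTube_of_mem U ρ b (fun i => α i.succ) ((α 0)⁻¹ • ⟨x, hx⟩ : tube U)
    rw [SubMulAction.val_smul, orbitMap_smul] at e1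
    have e2 := fun β => extendTube_of_mem U ρ b β ⟨x, hx⟩
    dsimp only at key e1 e2
    simp only [e1, e2, key, smul_real_smul, smul_add, Finset.smul_sum]
    congr 1
    exact Finset.sum_congr rfl fun j _ => smul_comm _ _ _
  · have h0 : ρ (orbitMap G X x) = 0 :=
      image_eq_zero_of_notMem_tsupport fun h => hx (hρ h)
    rw [extendTube_of_eq_zero U ρ b _ (x := (α 0)⁻¹ • x) (by rw [orbitMap_smul, h0]), h0]
    simp [extendTube_of_eq_zero U ρ b _ h0]

/-- Local vanishing implies global vanishing if the orbit space is paracompact Hausdorff. -/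
theorem VanishLocally.subsingleton_H (hV : VanishLocally G X V)
    [T2Space (MulAction.orbitRel.Quotient G X)] [ParacompactSpace (MulAction.orbitRel.Quotient G X)]
    (r : ℕ) (hr : 1 ≤ r) : Subsingleton (H G (MapModule G X V) r) := by
  obtain ⟨r, rfl⟩ := Nat.exists_eq_add_of_le' hr
  rw [subsingleton_H_succ_iff]
  intro c hc
  choose W hpW hW using hV
  have hb : ∀ p, ∃ b : Cochain G (MapModule G (tube (W p)) V) r,
      coboundary G _ r b = restrictTube (W p) c := fun p =>
    (subsingleton_H_succ_iff r).1 (hW p (W p) (hpW p) le_rfl (r + 1) hr) _ (by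
      rw [coboundary_restrictTube, hc]; rfl)
  choose b hb using hb
  obtain ⟨ρ, hρ⟩ := PartitionOfUnity.exists_isSubordinate isClosed_univ
    (fun p => (W p : Set (MulAction.orbitRel.Quotient G X))) (fun p => (W p).isOpen)
    fun p _ => mem_iUnion.2 ⟨p, hpW p⟩
  have hsupp : ∀ (α : Fin r → G) (x : X),
      (Function.support fun p => extendTube (W p) (ρ p) (b p) α x) ⊆
        ρ.finsupport (orbitMap G X x) := fun α x p hp => by
    rw [Finset.mem_coe, PartitionOfUnity.mem_finsupport]
    exact fun h => hp (extendTube_of_eq_zero _ _ _ _ h)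
  have hcont : Continuous fun q : (Fin r → G) × X =>
      ∑ᶠ p, extendTube (W p) (ρ p) (b p) q.1 q.2 := by
    refine continuous_finsum (fun p => continuous_extendTube (W p) (ρ p) (b p) (hρ p)) ?_
    refine (ρ.locallyFinite.preimage_continuous
      (continuous_orbitMap.comp (continuous_snd (X := Fin r → G)))).subset fun p q hq => ?_
    exact fun h => hq (extendTube_of_eq_zero _ _ _ _ h)
  refine ⟨mkCochain (fun α x => ∑ᶠ p, extendTube (W p) (ρ p) (b p) α x) hcont,
    mapCochain_ext fun α x => ?_⟩
  -- The coboundary at `x` sees a cochain only on the orbit of `x`, and there the locally finite sum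
  -- equals one fixed finite sum `d`, to which additivity of `∂` applies.
  let s := ρ.finsupport (orbitMap G X x)
  let d : Cochain G (MapModule G X V) r :=
    ∑ p ∈ s, mkCochain _ (continuous_extendTube (W p) (ρ p) (b p) (hρ p))
  have hd : ∀ β y, d β y = ∑ p ∈ s, extendTube (W p) (ρ p) (b p) β y := fun β y => by
    simp only [d, ← MapModule.evalHom_apply (G := G), ContinuousMap.sum_apply, map_sum]
    rfl
  rw [coboundary_map_congr (d := d) fun β g => ?_]
  · simp only [d, map_sum, ContinuousMap.sum_apply]
    rw [← MapModule.evalHom_apply (G := G), map_sum]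
    simp only [MapModule.evalHom_apply, coboundary_extendTube _ _ _ (hρ _) c (hb _)]
    rw [← Finset.sum_smul, ρ.sum_finsupport (mem_univ _), one_smul]
  · rw [hd, mkCochain_apply]
    refine finsum_eq_sum_of_support_subset _ ?_
    simpa only [orbitMap_smul] using hsupp β (g • x)

end Localization

end ContCohomology

/-! ### Weak integrals in quasi-complete locally convex spaces. -/

section WeakIntegral

open MeasureTheory Topology Set

/-- In a locally convex Hausdorff space, continuous linear functionals separate points. -/
theorem eq_of_forall_strongDual_eq {V : Type*} [AddCommGroup V] [Module ℝ V]
    [TopologicalSpace V] [IsTopologicalAddGroup V] [ContinuousSMul ℝ V] [LocallyConvexSpace ℝ V]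
    [T2Space V] {v w : V} (h : ∀ φ : StrongDual ℝ V, φ v = φ w) : v = w := by
  by_contra hvw
  obtain ⟨φ, hφ⟩ := geometric_hahn_banach_point_point hvw
  exact hφ.ne (h φ)

/-- In a locally convex space the closed convex neighbourhoods of zero form a basis. -/
theorem exists_isClosed_convex_mem_nhds_zero_subset {V : Type*} [AddCommGroup V] [Module ℝ V]
    [TopologicalSpace V] [IsTopologicalAddGroup V] [ContinuousSMul ℝ V] [LocallyConvexSpace ℝ V]
    {N : Set V} (hN : N ∈ 𝓝 (0 : V)) :
    ∃ U ∈ 𝓝 (0 : V), IsClosed U ∧ Convex ℝ U ∧ U ⊆ N := by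
  obtain ⟨N', hN', hc, hNN⟩ := exists_mem_nhds_isClosed_subset hN
  obtain ⟨U, ⟨hU, hUc⟩, hUN⟩ := (LocallyConvexSpace.convex_basis_zero ℝ V).mem_iff.1 hN'
  exact ⟨closure U, Filter.mem_of_superset hU subset_closure, isClosed_closure,
    Convex.closure hUc, (closure_minimal hUN hc).trans hNN⟩

variable {T V : Type*} [TopologicalSpace T] [MeasurableSpace T] [OpensMeasurableSpace T]
  (μ : Measure T) [IsFiniteMeasureOnCompacts μ]
  [AddCommGroup V] [Module ℝ V] [UniformSpace V] [IsUniformAddGroup V]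
  [ContinuousSMul ℝ V] [LocallyConvexSpace ℝ V]

theorem setIntegral_tsupport_strongDual_comp {f : T → V}
    (φ : StrongDual ℝ V) : ∫ t in tsupport f, φ (f t) ∂μ = ∫ t, φ (f t) ∂μ :=
  setIntegral_eq_integral_of_forall_compl_eq_zero fun t ht => by
    rw [image_eq_zero_of_notMem_tsupport ht, map_zero]

/-- A continuous compactly supported function with values in a quasi-complete locally convex
space has an integral. -/
theorem exists_weakIntegral [QuasiCompleteSpace ℝ V] {f : T → V} (hf : Continuous f)
    (hs : HasCompactSupport f) :
    ∃ v : V, ∀ φ : StrongDual ℝ V, φ v = ∫ t, φ (f t) ∂μ := by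
  have hK : IsCompact (tsupport f) := hs
  -- The mean value used below needs a support of nonzero measure.
  by_cases h0 : μ (tsupport f) = 0
  · refine ⟨0, fun φ => ?_⟩
    rw [map_zero, ← setIntegral_tsupport_strongDual_comp, setIntegral_measure_zero _ h0]
  let C : Set V := closure (convexHull ℝ (f '' tsupport f))
  have hC : IsCompact C := isCompact_closure_of_totallyBounded_quasiComplete (𝕜 := ℝ)
    (hK.image hf).totallyBounded.convexHull
  have hCc : Convex ℝ C := (convex_convexHull ℝ _).closure
  have hfC : ∀ t ∈ tsupport f, f t ∈ C := fun t ht =>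
    subset_closure (subset_convexHull ℝ _ (mem_image_of_mem f ht))
  -- By compactness of `C`, finitely many functionals at a time suffice. They form a map `L` to a
  -- finite-dimensional space, where the mean of `L ∘ f` lies in the closed convex set `L(C)`.
  have key := hC.inter_iInter_nonempty
    (fun φ : StrongDual ℝ V => {y | φ y = ⨍ t in tsupport f, φ (f t) ∂μ})
    (fun φ => isClosed_eq φ.continuous continuous_const) fun u => by
      let L : V →L[ℝ] (u → ℝ) := ContinuousLinearMap.pi fun i => i.1
      have hL : IsCompact (L '' C) := hC.image L.continuous
      have hint : Integrable (fun t => L (f t)) μ :=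
        (L.continuous.comp hf).integrable_of_hasCompactSupport
          (hs.comp_left (g := L) (map_zero L))
      obtain ⟨y, hy, hyL⟩ := (hCc.linear_image L.toLinearMap).set_average_mem (μ := μ)
        (t := tsupport f) (f := fun t => L (f t)) hL.isClosed h0 hK.measure_ne_top
        (ae_restrict_of_forall_mem (isClosed_tsupport f).measurableSet
          fun t ht => ⟨f t, hfC t ht, rfl⟩) hint.integrableOn
      refine ⟨y, hy, mem_iInter₂.2 fun φ hφ => ?_⟩
      have h1 := congrFun hyL ⟨φ, hφ⟩
      have h2 : (∫ t in tsupport f, L (f t) ∂μ) ⟨φ, hφ⟩ = ∫ t in tsupport f, φ (f t) ∂μ :=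
        ((ContinuousLinearMap.proj (R := ℝ) (φ := fun _ : u => ℝ) ⟨φ, hφ⟩).integral_comp_comm
          hint.integrableOn).symm
      rw [setAverage_eq, Pi.smul_apply, h2, ← setAverage_eq] at h1
      exact h1
  obtain ⟨y, -, hy⟩ := key
  refine ⟨μ.real (tsupport f) • y, fun φ => ?_⟩
  have h1 : φ y = ⨍ t in tsupport f, φ (f t) ∂μ := mem_iInter.1 hy φ
  have h2 : μ.real (tsupport f) ≠ 0 := by
    rw [Measure.real, ENNReal.toReal_ne_zero]
    exact ⟨h0, hK.measure_ne_top⟩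
  rw [map_smul, h1, setAverage_eq, smul_inv_smul₀ h2, setIntegral_tsupport_strongDual_comp]

/-- The integral of a vector-valued function, characterized by its pairings with the continuous
linear functionals. -/
noncomputable def weakIntegral (f : T → V) : V :=
  -- The value is arbitrary if no such vector exists.
  Classical.epsilon fun v => ∀ φ : StrongDual ℝ V, φ v = ∫ t, φ (f t) ∂μ

theorem strongDual_weakIntegral [QuasiCompleteSpace ℝ V] {f : T → V} (hf : Continuous f)
    (hs : HasCompactSupport f) (φ : StrongDual ℝ V) :
    φ (weakIntegral μ f) = ∫ t, φ (f t) ∂μ :=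
  Classical.epsilon_spec (exists_weakIntegral μ hf hs) φ

/-- The integral depends continuously on parameters, if the supports are locally contained in
compact sets. -/
theorem continuous_weakIntegral [QuasiCompleteSpace ℝ V] [T2Space T] {Z : Type*}
    [TopologicalSpace Z] {F : Z → T → V} (hF : Continuous fun p : Z × T => F p.1 p.2)
    (hs : ∀ z₀, ∃ K : Set T, IsCompact K ∧ ∀ᶠ z in 𝓝 z₀, ∀ t ∉ K, F z t = 0) :
    Continuous fun z => weakIntegral μ (F z) := by
  have hFc : ∀ z, Continuous (F z) := fun z => hF.comp (Continuous.prodMk_right z)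
  have hFs : ∀ z, HasCompactSupport (F z) := fun z => by
    obtain ⟨K, hK, h⟩ := hs z
    exact HasCompactSupport.intro hK h.self_of_nhds
  refine continuous_iff_continuousAt.2 fun z₀ => ?_
  obtain ⟨K, hK, hz⟩ := hs z₀
  rw [ContinuousAt, ← tendsto_sub_nhds_zero_iff]
  intro N hN
  obtain ⟨U, hU, hUc, hUconv, hUN⟩ := exists_isClosed_convex_mem_nhds_zero_subset hN
  set m : ℝ := μ.real K with hm
  have hm0 : 0 ≤ m := measureReal_nonneg
  -- Compactness of `K` makes the estimate uniform in `t`. The factor `m + 1` stays positive when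
  -- `K` is null.
  have htube : ∀ᶠ z in 𝓝 z₀, ∀ t ∈ K, (m + 1) • (F z t - F z₀ t) ∈ U := by
    refine hK.eventually_forall_of_forall_eventually fun t _ => ?_
    have hc : Continuous fun p : Z × T => (m + 1) • (F p.1 p.2 - F z₀ p.2) :=
      (hF.sub ((hFc z₀).comp continuous_snd)).const_smul (m + 1)
    refine hc.continuousAt.eventually ?_
    simpa using hU
  refine Filter.mem_map.2 ?_
  filter_upwards [hz, htube] with z hzK hzU
  refine hUN ?_
  -- A functional separating the difference of the integrals from `U` is below `u / (m + 1)` on each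
  -- difference of integrands, so its integral over `K` cannot exceed `u`.
  by_contra hnot
  obtain ⟨φ, u, hφ, hu⟩ := geometric_hahn_banach_closed_point hUconv hUc hnot
  have hu0 : 0 < u := by simpa using hφ 0 (mem_of_mem_nhds hU)
  have hint : ∀ z, Integrable (fun t => φ (F z t)) μ := fun z =>
    (φ.continuous.comp (hFc z)).integrable_of_hasCompactSupport
      ((hFs z).comp_left (g := φ) (map_zero φ))
  have hle : φ (weakIntegral μ (F z) - weakIntegral μ (F z₀)) ≤ m * (u / (m + 1)) := by
    rw [map_sub, strongDual_weakIntegral μ (hFc z) (hFs z),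
      strongDual_weakIntegral μ (hFc z₀) (hFs z₀), ← integral_sub (hint z) (hint z₀),
      ← setIntegral_eq_integral_of_forall_compl_eq_zero (s := K) fun t ht => by
        rw [hzK t ht, hz.self_of_nhds t ht, sub_self]]
    calc ∫ t in K, (φ (F z t) - φ (F z₀ t)) ∂μ
        ≤ ∫ _ in K, u / (m + 1) ∂μ := by
          refine setIntegral_mono_on ((hint z).sub (hint z₀)).integrableOn
            (integrableOn_const hK.measure_ne_top) hK.measurableSet fun t ht => ?_
          have := hφ _ (hzU t ht)
          rw [map_smul, map_sub, smul_eq_mul] at this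
          rw [le_div_iff₀ (by positivity)]
          linarith
      _ = m * (u / (m + 1)) := by rw [setIntegral_const, smul_eq_mul]
  have : m * (u / (m + 1)) ≤ u := by
    rw [← mul_div_assoc, div_le_iff₀ (by positivity)]
    nlinarith
  linarith

end WeakIntegral

/-! ### Paracompactness of the orbit space. -/

section Paracompact

open Topology Set

/-- In a paracompact locally compact Hausdorff space, connected components are `σ`-compact. -/
theorem isSigmaCompact_connectedComponent {X : Type*} [TopologicalSpace X] [T2Space X]
    [LocallyCompactSpace X] [ParacompactSpace X] (x : X) :
    IsSigmaCompact (connectedComponent x) := by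
  choose K hK hKx using fun y : X => exists_compact_mem_nhds y
  obtain ⟨v, hvo, hvc, hvf, hvK⟩ := precise_refinement (fun y => interior (K y))
    (fun y => isOpen_interior)
    (iUnion_eq_univ_iff.2 fun y => ⟨y, mem_interior_iff_mem_nhds.2 (hKx y)⟩)
  have hcl : ∀ i, IsCompact (closure (v i)) := fun i =>
    (hK i).closure_of_subset ((hvK i).trans interior_subset)
  obtain ⟨a, ha⟩ := iUnion_eq_univ_iff.1 hvc x
  -- Each stage adds the closures of all cover members meeting the previous one; by local finiteness
  -- there are finitely many. The union is clopen, since a member meeting it lies in it.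
  let S : ℕ → Set X := fun n => Nat.rec (closure (v a))
    (fun _ s => ⋃ i ∈ {i | (v i ∩ s).Nonempty}, closure (v i)) n
  have hS : ∀ n, IsCompact (S n) := fun n => by
    induction n with
    | zero => exact hcl a
    | succ n ih => exact (hvf.finite_nonempty_inter_compact ih).isCompact_biUnion fun i _ => hcl i
  have hstep : ∀ i, (v i ∩ ⋃ n, S n).Nonempty → v i ⊆ ⋃ n, S n := by
    rintro i ⟨z, hzi, hz⟩
    obtain ⟨n, hn⟩ := mem_iUnion.1 hz
    refine subset_closure.trans (Subset.trans ?_ (subset_iUnion S (n + 1)))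
    exact subset_biUnion_of_mem (u := fun i => closure (v i)) (show i ∈ _ from ⟨z, hzi, hn⟩)
  have hclopen : IsClopen (⋃ n, S n) := by
    refine ⟨⟨isOpen_iff_forall_mem_open.2 fun y hy => ?_⟩,
      isOpen_iff_forall_mem_open.2 fun y hy => ?_⟩ <;>
    obtain ⟨i, hi⟩ := iUnion_eq_univ_iff.1 hvc y
    · exact ⟨v i, fun z hz hzS => hy (hstep i ⟨z, hz, hzS⟩ hi), hvo i, hi⟩
    · exact ⟨v i, hstep i ⟨y, hi, hy⟩, hvo i, hi⟩
  exact (isSigmaCompact_iUnion_of_isCompact S hS).of_isClosed_subset isClosed_connectedComponent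
    (hclopen.connectedComponent_subset (mem_iUnion.2 ⟨0, subset_closure ha⟩))

/-- A space is paracompact if it is a topological disjoint union of paracompact spaces. -/
theorem ParacompactSpace.of_fibers {Y D : Type*} [TopologicalSpace Y] [TopologicalSpace D]
    [DiscreteTopology D] {q : Y → D} (hq : Continuous q)
    (h : ∀ d, ParacompactSpace (q ⁻¹' {d})) : ParacompactSpace Y := by
  refine ⟨fun α s ho hs => ?_⟩
  have hd : ∀ d, ∃ v : α → Set (q ⁻¹' {d}), (∀ a, IsOpen (v a)) ∧ ⋃ i, v i = univ ∧
      LocallyFinite v ∧ ∀ a, v a ⊆ Subtype.val ⁻¹' (s a) := fun d =>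
    precise_refinement _ (fun a => (ho a).preimage continuous_subtype_val)
      (by rw [← preimage_iUnion, hs, preimage_univ])
  choose v hvo hvc hvf hvs using hd
  have hopen : ∀ d, IsOpen (q ⁻¹' {d}) := fun d => (isOpen_discrete _).preimage hq
  refine ⟨α, fun a => ⋃ d, Subtype.val '' v d a,
    fun a => isOpen_iUnion fun d => (hopen d).isOpenMap_subtype_val _ (hvo d a), ?_, fun y => ?_,
    fun a => ⟨a, iUnion_subset fun d => image_subset_iff.2 (hvs d a)⟩⟩
  · refine iUnion_eq_univ_iff.2 fun y => ?_
    obtain ⟨a, ha⟩ := iUnion_eq_univ_iff.1 (hvc (q y)) ⟨y, rfl⟩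
    exact ⟨a, mem_iUnion.2 ⟨q y, _, ha, rfl⟩⟩
  · obtain ⟨N, hN, hfin⟩ := hvf (q y) ⟨y, rfl⟩
    refine ⟨Subtype.val '' N, (hopen (q y)).isOpenMap_subtype_val.image_mem_nhds hN,
      hfin.subset ?_⟩
    rintro a ⟨_, hz, ⟨z, hzN, rfl⟩⟩
    obtain ⟨d, w, hw, hwz⟩ := mem_iUnion.1 hz
    obtain rfl : q y = d := by rw [← show q z = q y from z.2, ← hwz]; exact w.2
    obtain rfl : w = z := Subtype.ext hwz
    exact ⟨w, hw, hzN⟩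

/-- A locally connected, locally compact Hausdorff space with `σ`-compact components is
paracompact. -/
theorem ParacompactSpace.of_isSigmaCompact_connectedComponent {Y : Type*} [TopologicalSpace Y]
    [T2Space Y] [LocallyCompactSpace Y] [LocallyConnectedSpace Y]
    (h : ∀ y : Y, IsSigmaCompact (connectedComponent y)) : ParacompactSpace Y := by
  -- Local connectedness makes the space of components discrete.
  refine ParacompactSpace.of_fibers (q := ((↑) : Y → ConnectedComponents Y))
    ConnectedComponents.continuous_coe fun d => ?_
  obtain ⟨y, rfl⟩ := ConnectedComponents.surjective_coe d
  rw [connectedComponents_preimage_singleton]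
  have : SigmaCompactSpace (connectedComponent y) := isSigmaCompact_iff_sigmaCompactSpace.1 (h y)
  have : LocallyCompactSpace (connectedComponent y) :=
    isClosed_connectedComponent.isClosedEmbedding_subtypeVal.locallyCompactSpace
  infer_instance

/-- The orbit space of a paracompact, locally connected, locally compact Hausdorff space is
paracompact, if it is Hausdorff. -/
theorem paracompactSpace_orbit_quotient (G X : Type*) [Group G] [TopologicalSpace X] [T2Space X]
    [LocallyCompactSpace X] [LocallyConnectedSpace X] [ParacompactSpace X] [MulAction G X]
    [ContinuousConstSMul G X] [T2Space (MulAction.orbitRel.Quotient G X)] :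
    ParacompactSpace (MulAction.orbitRel.Quotient G X) := by
  have hπ : IsQuotientMap (ContCohomology.orbitMap G X) := isQuotientMap_quotient_mk'
  have hπo : IsOpenMap (ContCohomology.orbitMap G X) := isOpenMap_quotient_mk'_mul
  have : LocallyConnectedSpace (MulAction.orbitRel.Quotient G X) := hπ.locallyConnectedSpace
  have : LocallyCompactSpace (MulAction.orbitRel.Quotient G X) :=
    (IsOpenQuotientMap.mk hπ.surjective hπ.continuous hπo).locallyCompactSpace
  refine ParacompactSpace.of_isSigmaCompact_connectedComponent fun p => ?_
  obtain ⟨x, rfl⟩ := hπ.surjective p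
  -- Group elements carry components into components: if the component of `y` meets the saturation
  -- of that of `x`, a translate of it lies in the component of `x`. The image is thus clopen and
  -- `σ`-compact, and it contains the component of `π(x)`.
  have hclosed : IsClosed (ContCohomology.orbitMap G X '' connectedComponent x) := by
    rw [← hπ.isClosed_preimage]
    refine ⟨isOpen_iff_forall_mem_open.2 fun y hy =>
      ⟨connectedComponent y, fun z hz hzS => hy ?_, isOpen_connectedComponent,
        mem_connectedComponent⟩⟩
    obtain ⟨w, hw, hwz⟩ := hzS
    obtain ⟨g, hg⟩ : ∃ g : G, g • w = z := by
      obtain ⟨g, hg⟩ := Quotient.exact hwz.symm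
      exact ⟨g, hg⟩
    have hpre : IsPreconnected ((fun u : X => g⁻¹ • u) '' connectedComponent y) :=
      isPreconnected_connectedComponent.image _ (continuous_const_smul g⁻¹).continuousOn
    have hwm : w ∈ (fun u : X => g⁻¹ • u) '' connectedComponent y :=
      ⟨z, hz, by simp [← hg]⟩
    have hyw := hpre.subset_connectedComponent hwm ⟨y, mem_connectedComponent, rfl⟩
    rw [← connectedComponent_eq hw] at hyw
    exact ⟨g⁻¹ • y, hyw, ContCohomology.orbitMap_smul _ _⟩
  exact ((isSigmaCompact_connectedComponent x).image hπ.continuous).of_isClosed_subset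
    isClosed_connectedComponent
    (IsClopen.connectedComponent_subset
      ⟨hclosed, hπo _ isOpen_connectedComponent⟩ ⟨x, mem_connectedComponent, rfl⟩)

end Paracompact

namespace ContCohomology

open MeasureTheory Topology Set

/-! ### Haar averages along orbits, weighted by a cutoff function. -/

section OrbitAverage

variable {G Y V : Type*} [Group G] [TopologicalSpace G] [IsTopologicalGroup G]
  [T2Space G] [MeasurableSpace G] [BorelSpace G] (μ : Measure G) [μ.IsHaarMeasure]
  [TopologicalSpace Y] [MulAction G Y] [ContinuousSMul G Y]
  [AddCommGroup V] [Module ℝ V] [UniformSpace V] [IsUniformAddGroup V]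
  [ContinuousSMul ℝ V] [LocallyConvexSpace ℝ V] [T2Space V]
  [DistribMulAction G V] [ContinuousSMul G V]

/-- A nonnegative function on a `G`-space that is positive somewhere on every orbit and whose
support meets every orbit in a compact set of group elements, locally uniformly. -/
structure IsCutoff (G : Type*) {Y : Type*} [Group G] [TopologicalSpace G] [TopologicalSpace Y]
    [MulAction G Y] (f : C(Y, ℝ)) : Prop where
  nonneg : ∀ y, 0 ≤ f y
  exists_pos : ∀ y, ∃ g : G, 0 < f (g • y)
  exists_compact : ∀ y, ∃ K : Set G, IsCompact K ∧ ∀ᶠ z in 𝓝 y, ∀ g ∉ K, f (g⁻¹ • z) = 0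

/-- The integral of a function over an orbit. -/
noncomputable def orbitMass (f : C(Y, ℝ)) (y : Y) : ℝ := ∫ g : G, f (g⁻¹ • y) ∂μ

theorem continuous_inv_smul_comp (f : C(Y, ℝ)) (y : Y) :
    Continuous fun g : G => f (g⁻¹ • y) := by fun_prop

/-- The weight `f(g⁻¹y)` turns translation of `y` into left translation of the variable, so left
invariance suffices and no modular function appears. -/
theorem orbitMass_smul (f : C(Y, ℝ)) (g : G) (y : Y) : orbitMass μ f (g • y) = orbitMass μ f y := by
  unfold orbitMass
  rw [← integral_mul_left_eq_self _ g]
  simp [mul_smul]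

/-- The weighted average of a function `h` on `G` along the orbit of `y`. -/
noncomputable def orbitAverage (f : C(Y, ℝ)) (y : Y) (h : G → V) : V :=
  (orbitMass μ f y)⁻¹ • weakIntegral μ fun g => f (g⁻¹ • y) • h g

variable {f : C(Y, ℝ)} (hf : IsCutoff G f)
include hf

theorem IsCutoff.hasCompactSupport (y : Y) : HasCompactSupport fun g : G => f (g⁻¹ • y) := by
  obtain ⟨K, hK, h⟩ := hf.exists_compact y
  exact HasCompactSupport.intro hK h.self_of_nhds

theorem IsCutoff.orbitMass_pos (y : Y) : 0 < orbitMass μ f y := by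
  obtain ⟨g, hg⟩ := hf.exists_pos y
  refine Continuous.integral_pos_of_hasCompactSupport_nonneg_nonzero (x := g⁻¹)
    (continuous_inv_smul_comp f y) (hf.hasCompactSupport y) (fun _ => hf.nonneg _) ?_
  simpa using hg.ne'

theorem IsCutoff.continuous_orbitMass : Continuous (orbitMass μ f) := by
  refine continuous_iff_continuousAt.2 fun y => ?_
  obtain ⟨K, hK, h⟩ := hf.exists_compact y
  refine ContinuousOn.continuousAt (s := {z | ∀ g ∉ K, f (g⁻¹ • z) = 0}) ?_ h
  refine continuousOn_integral_of_compact_support hK ?_ fun z g hz hg => hz g hg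
  exact Continuous.continuousOn (by unfold Function.uncurry; fun_prop)

variable [QuasiCompleteSpace ℝ V]

theorem IsCutoff.strongDual_orbitAverage (y : Y) {h : G → V} (hh : Continuous h)
    (φ : StrongDual ℝ V) :
    φ (orbitAverage μ f y h) = (orbitMass μ f y)⁻¹ * ∫ g : G, f (g⁻¹ • y) * φ (h g) ∂μ := by
  unfold orbitAverage
  rw [map_smul, strongDual_weakIntegral μ (f := fun g : G => f (g⁻¹ • y) • h g)
    ((continuous_inv_smul_comp f y).smul hh) (hf.hasCompactSupport y).smul_right]
  simp only [map_smul, smul_eq_mul]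

theorem IsCutoff.orbitAverage_const (y : Y) (v : V) :
    orbitAverage μ f y (fun _ : G => v) = v :=
  eq_of_forall_strongDual_eq fun φ => by
    rw [hf.strongDual_orbitAverage μ y continuous_const, integral_mul_const, ← mul_assoc]
    exact (congrArg (· * φ v) (inv_mul_cancel₀ (hf.orbitMass_pos μ y).ne')).trans (one_mul _)

theorem IsCutoff.orbitAverage_add (y : Y) {h k : G → V} (hh : Continuous h) (hk : Continuous k) :
    orbitAverage μ f y (fun g => h g + k g) = orbitAverage μ f y h + orbitAverage μ f y k :=
  eq_of_forall_strongDual_eq fun φ => by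
    have hint : ∀ {h : G → V}, Continuous h →
        Integrable (fun g : G => f (g⁻¹ • y) * φ (h g)) μ := fun hh =>
      ((continuous_inv_smul_comp f y).mul (φ.continuous.comp hh)).integrable_of_hasCompactSupport
        (hf.hasCompactSupport y).mul_right
    rw [map_add, hf.strongDual_orbitAverage μ y hh, hf.strongDual_orbitAverage μ y hk,
      hf.strongDual_orbitAverage μ y (h := fun g => h g + k g) (hh.add hk), ← mul_add, ← integral_add (hint hh) (hint hk)]
    simp only [map_add, mul_add]

/-- Averaging along the orbit of `y`, as a homomorphism. -/
noncomputable def IsCutoff.averageHom (y : Y) : C(G, V) →+ V :=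
  AddMonoidHom.mk' (fun h => orbitAverage μ f y h) fun h k =>
    hf.orbitAverage_add μ y h.continuous k.continuous

/-- The averages are equivariant. -/
theorem IsCutoff.smul_orbitAverage (a : G) (y : Y) {h : G → V} (hh : Continuous h) :
    a • orbitAverage μ f (a⁻¹ • y) h = orbitAverage μ f y fun g => a • h (a⁻¹ * g) :=
  eq_of_forall_strongDual_eq fun φ => by
    let A : V →L[ℝ] V :=
      { toFun := fun v => a • v
        map_add' := smul_add a
        map_smul' := fun t v => smul_real_smul a t v
        cont := continuous_const_smul a }
    have h1 := hf.strongDual_orbitAverage μ (a⁻¹ • y) hh (φ.comp A)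
    have h2 := hf.strongDual_orbitAverage μ y (h := fun g => a • h (a⁻¹ * g))
      ((hh.comp (continuous_const_mul a⁻¹)).const_smul a) φ
    rw [h2, ← integral_mul_left_eq_self _ a]
    refine h1.trans ?_
    rw [orbitMass_smul]
    simp [A, mul_smul]

/-- The averages are jointly continuous. -/
theorem IsCutoff.continuous_orbitAverage {Z : Type*} [TopologicalSpace Z] {y : Z → Y}
    (hy : Continuous y) {h : Z → G → V} (hh : Continuous fun p : Z × G => h p.1 p.2) :
    Continuous fun z => orbitAverage μ f (y z) (h z) := by
  refine (((hf.continuous_orbitMass μ).comp hy).inv₀ fun z =>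
    (hf.orbitMass_pos μ (y z)).ne').smul ?_
  refine continuous_weakIntegral μ ?_ fun z => ?_
  · refine Continuous.smul ?_ hh
    fun_prop
  · obtain ⟨K, hK, hz⟩ := hf.exists_compact (y z)
    refine ⟨K, hK, (hy.continuousAt.eventually hz).mono fun w hw g hg => ?_⟩
    rw [hw g hg, zero_smul]

end OrbitAverage

/-! ### Combinatorics of the contracting homotopy. -/

section Homotopy

variable {G : Type*} [Group G]

/-- The tuple `(α₁, …, αᵣ, (α₁⋯αᵣ)⁻¹ β)`, whose product is `β`. -/
def snocProd {r : ℕ} (α : Fin r → G) (β : G) : Fin (r + 1) → G :=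
  Fin.snoc (α := fun _ => G) α ((Fin.partialProd α (Fin.last r))⁻¹ * β)

theorem snocProd_zero {r : ℕ} (α : Fin (r + 1) → G) (β : G) : snocProd α β 0 = α 0 := by
  rw [snocProd, ← Fin.castSucc_zero, Fin.snoc_castSucc]

/-- Dropping the first entry changes the total product to `(α 0)⁻¹ * β`;
`IsCutoff.smul_orbitAverage` absorbs this shift. -/
theorem snocProd_succ {r : ℕ} (α : Fin (r + 1) → G) (β : G) :
    (fun i => snocProd α β i.succ) = snocProd (fun i => α i.succ) ((α 0)⁻¹ * β) := by
  funext i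
  refine Fin.lastCases ?_ (fun j => ?_) i
  · rw [snocProd, snocProd, Fin.succ_last, Fin.snoc_last, Fin.snoc_last, ← Fin.succ_last,
      Fin.partialProd_succ', mul_inv_rev, mul_assoc]
    rfl
  · rw [snocProd, snocProd, Fin.succ_castSucc, Fin.snoc_castSucc, Fin.snoc_castSucc]

/-- This face does not involve `β`, so averaging its term returns the cocycle itself. -/
theorem contractNth_last_snocProd {r : ℕ} (α : Fin r → G) (β : G) :
    Fin.contractNth (Fin.last r) (· * ·) (snocProd α β) = α := by
  funext k
  rw [Fin.contractNth_apply_of_lt _ _ _ _ k.2, snocProd, Fin.snoc_castSucc]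

/-- Merging neighbours preserves the total product `β`, which determines the last entry. For `j`
last, the merged entry is `αᵣ₊₁ (α₁⋯αᵣ₊₁)⁻¹ β = (α₁⋯αᵣ)⁻¹ β`. -/
theorem contractNth_castSucc_snocProd {r : ℕ} (j : Fin (r + 1)) (α : Fin (r + 1) → G) (β : G) :
    Fin.contractNth j.castSucc (· * ·) (snocProd α β) =
      snocProd (Fin.contractNth j (· * ·) α) β := by
  funext k
  refine Fin.lastCases ?_ (fun k => ?_) k
  · rw [snocProd, snocProd, Fin.snoc_last, Fin.partialProd_contractNth, Function.comp_apply]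
    rcases (Fin.le_last j).eq_or_lt with rfl | hj
    · rw [Fin.contractNth_apply_of_eq _ _ _ _ (by simp), Fin.succ_last,
        Fin.snoc_last, Fin.snoc_castSucc, Fin.succAbove_last, ← Fin.succ_last,
        Fin.partialProd_succ, mul_inv_rev, mul_assoc, mul_inv_cancel_left]
    · rw [Fin.contractNth_apply_of_gt _ _ _ _ (by simpa using Fin.lt_def.1 hj), Fin.succ_last,
        Fin.snoc_last, Fin.succAbove_of_le_castSucc _ _ (by
          rw [Fin.le_def, Fin.val_succ, Fin.val_castSucc]
          exact Fin.lt_def.1 hj), Fin.succ_last]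
  · rw [snocProd, snocProd, Fin.snoc_castSucc]
    unfold Fin.contractNth
    simp only [Fin.val_castSucc, Fin.snoc_castSucc, ← Fin.castSucc_succ]

theorem continuous_partialProd [TopologicalSpace G] [ContinuousMul G] {r : ℕ} (i : Fin (r + 1)) :
    Continuous fun α : Fin r → G => Fin.partialProd α i := by
  refine Fin.induction ?_ (fun i ih => ?_) i
  · simpa using continuous_const
  · simp only [Fin.partialProd_succ]
    exact ih.mul (continuous_apply i)

theorem continuous_snocProd [TopologicalSpace G] [IsTopologicalGroup G] {r : ℕ} :
    Continuous fun p : (Fin r → G) × G => snocProd p.1 p.2 :=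
  Continuous.finSnoc (A := fun _ => G) continuous_fst
    ((((continuous_partialProd _).comp continuous_fst).inv).mul continuous_snd)

end Homotopy

/-! ### Vanishing in the presence of a cutoff function. -/

section Vanishing

variable {G Y V : Type*} [Group G] [TopologicalSpace G] [IsTopologicalGroup G]
  [LocallyCompactSpace G] [T2Space G]
  [TopologicalSpace Y] [LocallyCompactSpace Y] [MulAction G Y] [ContinuousSMul G Y]
  [AddCommGroup V] [Module ℝ V] [UniformSpace V] [IsUniformAddGroup V]
  [ContinuousSMul ℝ V] [LocallyConvexSpace ℝ V] [T2Space V]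
  [DistribMulAction G V] [ContinuousSMul G V] [QuasiCompleteSpace ℝ V]

/-- The cohomology of `G` with coefficients in `C(Y, V)` vanishes if `Y` has a cutoff function. -/
theorem IsCutoff.subsingleton_H {f : C(Y, ℝ)} (hf : IsCutoff G f) (r : ℕ) :
    Subsingleton (H G (MapModule G Y V) (r + 1)) := by
  rw [subsingleton_H_succ_iff]
  intro c hc
  borelize G
  let μ : Measure G := Measure.haar
  have hcc := continuous_uncurry_cochain c
  let b : Cochain G (MapModule G Y V) r :=
    mkCochain (fun α y => orbitAverage μ f y fun β => c (snocProd α β) y)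
      (hf.continuous_orbitAverage μ continuous_snd
        (h := fun (p : (Fin r → G) × Y) β => c (snocProd p.1 β) p.2)
        (hcc.comp ((continuous_snocProd.comp
          ((continuous_fst.comp continuous_fst).prodMk continuous_snd)).prodMk
          (continuous_snd.comp continuous_fst))))
  have hsec : ∀ (s : ℕ) (y : Y) (d : Cochain G (MapModule G Y V) s),
      Continuous fun α => d α y := fun s y d =>
    (continuous_uncurry_cochain d).comp (Continuous.prodMk_left y)
  have hsn : ∀ (s : ℕ) (α : Fin s → G), Continuous (snocProd α) := fun s α =>
    continuous_snocProd.comp (Continuous.prodMk_right α)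
  -- Averaging the cocycle identity over `β` gives `∂ b + (-1)^(r+2) c = 0`, whence the sign.
  refine ⟨(-1 : ℤ) ^ (r + 1) • b, mapCochain_ext fun α y => ?_⟩
  -- the integrands of the terms of the coboundary
  let h₀ : C(G, V) := ⟨fun β => α 0 • c (fun i => snocProd α β i.succ) ((α 0)⁻¹ • y),
    ((hsec _ _ c).comp (continuous_pi fun i =>
      (continuous_apply i.succ).comp (hsn _ α))).const_smul _⟩
  let h₁ : Fin (r + 1) → C(G, V) := fun j =>
    ⟨fun β => c (snocProd (Fin.contractNth j (· * ·) α) β) y, (hsec _ _ c).comp (hsn _ _)⟩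
  let h₂ : C(G, V) := ContinuousMap.const G (c α y)
  have hsum : h₀ + ∑ j : Fin (r + 1), (-1 : ℤ) ^ ((j : ℕ) + 1) • h₁ j +
      (-1 : ℤ) ^ (r + 1 + 1) • h₂ = 0 := by
    ext β
    have h := coboundary_map_apply c (snocProd α β) y
    rw [hc, Fin.sum_univ_castSucc, contractNth_last_snocProd] at h
    simp only [contractNth_castSucc_snocProd, snocProd_zero, Fin.val_castSucc, Fin.val_last] at h
    rw [← add_assoc] at h
    rw [ContinuousMap.zero_apply, MapModule.zero_apply] at h
    simpa [h₀, h₁, h₂] using h.symm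
  have hE := congrArg (hf.averageHom μ y) hsum
  have e₀ : hf.averageHom μ y h₀ = α 0 • b (fun i => α i.succ) ((α 0)⁻¹ • y) := by
    refine Eq.trans ?_ (hf.smul_orbitAverage μ (α 0) y ((hsec _ _ c).comp (hsn _ _))).symm
    exact congrArg (orbitAverage μ f y) (funext fun β =>
      congrArg (fun a => α 0 • c a ((α 0)⁻¹ • y)) (snocProd_succ α β))
  have e₂ : hf.averageHom μ y h₂ = c α y := hf.orbitAverage_const μ y _
  have e₁ : ∀ j, hf.averageHom μ y (h₁ j) = b (Fin.contractNth j (· * ·) α) y := fun j => rfl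
  simp only [map_add, map_sum, map_zsmul, map_zero, e₀, e₁, e₂] at hE
  rw [← coboundary_map_apply, pow_succ, mul_neg_one, neg_smul, ← sub_eq_add_neg, sub_eq_zero] at hE
  rw [map_zsmul]
  have h3 : ((-1 : ℤ) ^ (r + 1) • coboundary G (MapModule G Y V) r b) α y =
      (-1 : ℤ) ^ (r + 1) • coboundary G (MapModule G Y V) r b α y := rfl
  rw [h3, hE, smul_smul, ← mul_pow, neg_one_mul, neg_neg, one_pow, one_smul]

end Vanishing

/-! ### Cutoff functions for proper actions. -/

section ProperAction

variable {G X V : Type*} [Group G] [TopologicalSpace G] [IsTopologicalGroup G]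
  [LocallyCompactSpace G] [T2Space G]
  [TopologicalSpace X] [LocallyCompactSpace X] [T2Space X] [MulAction G X]
  [AddCommGroup V] [Module ℝ V] [UniformSpace V] [IsUniformAddGroup V]
  [ContinuousSMul ℝ V] [LocallyConvexSpace ℝ V] [T2Space V]
  [DistribMulAction G V] [ContinuousSMul G V] [QuasiCompleteSpace ℝ V]

/-- For a proper action, the cohomology with coefficients in `π_* C_{X,V}` vanishes locally. -/
theorem vanishLocally_of_properSMul [ContinuousSMul G X] [ProperSMul G X] :
    VanishLocally G X V := by
  intro p
  obtain ⟨x, rfl⟩ : ∃ x, orbitMap G X x = p := Quotient.exists_rep p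
  obtain ⟨f, hfx, -, hfc, hf01⟩ := exists_continuous_one_zero_of_isCompact
    (isCompact_singleton (x := x)) isClosed_empty (disjoint_empty _)
  have hπo : IsOpenMap (orbitMap G X) := isOpenMap_quotient_mk'_mul
  -- `W` consists of the orbits on which `f` is positive somewhere, so `f` restricts to a cutoff
  -- function over every open `U ⊆ W`.
  refine ⟨⟨orbitMap G X '' {z | 0 < f z}, hπo _ (isOpen_lt continuous_const f.continuous)⟩,
    ⟨x, ?_, rfl⟩, fun U _ hU r hr => ?_⟩
  · rw [mem_ofPred_eq, hfx rfl]
    exact one_pos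
  obtain ⟨r, rfl⟩ := Nat.exists_eq_add_of_le' hr
  let F : C(tube U, ℝ) := ⟨fun z => f (z : X), f.continuous.comp continuous_subtype_val⟩
  refine IsCutoff.subsingleton_H (f := F) ⟨fun z => (hf01 _).1, fun z => ?_, fun z => ?_⟩ r
  · obtain ⟨w, hw, hwz⟩ := hU z.2
    obtain ⟨g, hg⟩ := Quotient.exact hwz
    exact ⟨g, by simpa [F, show g • (z : X) = w from hg] using hw⟩
  · obtain ⟨N, hN, hNz⟩ := exists_compact_mem_nhds (z : X)
    -- If `f(g⁻¹w) ≠ 0` with `w ∈ N`, then `g` translates the compact support of `f` to a set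
    -- meeting `N`; properness makes the set of such `g` compact.
    refine ⟨_, ProperSMul.isCompact_setOfPred_inter_nonempty (G := G) hfc.isCompact hN, ?_⟩
    filter_upwards [continuous_subtype_val.continuousAt.preimage_mem_nhds hNz] with w hw g hg
    by_contra h0
    refine hg ⟨(w : X), ?_, hw⟩
    rw [mem_smul_set_iff_inv_smul_mem]
    exact subset_tsupport _ h0

end ProperAction

end ContCohomology

theorem mainTheorem11
    {G : Type*} [Group G] [TopologicalSpace G] [IsTopologicalGroup G]
    [LocallyCompactSpace G] [T2Space G]
    {X : Type*} [TopologicalSpace X] [LocallyCompactSpace X] [T2Space X]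
    [MulAction G X] [ContinuousSMul G X]
    {V : Type*} [AddCommGroup V] [Module ℝ V] [UniformSpace V] [IsUniformAddGroup V]
    [ContinuousSMul ℝ V] [LocallyConvexSpace ℝ V] [T2Space V]
    [DistribMulAction G V] [ContinuousSMul G V] :
    -- the general vanishing theorem
    (ContCohomology.VanishLocally G X V →
      T2Space (MulAction.orbitRel.Quotient G X) →
      ParacompactSpace (MulAction.orbitRel.Quotient G X) →
      ∀ r : ℕ, 1 ≤ r →
        Subsingleton (ContCohomology.H G (ContCohomology.MapModule G X V) r)) ∧
    -- smooth proper actions of Lie groups on manifolds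
    (∀ {E : Type*} [NormedAddCommGroup E] [NormedSpace ℝ E] [FiniteDimensional ℝ E]
      [ChartedSpace E G] [LieGroup 𝓘(ℝ, E) ∞ G]
      {F : Type*} [NormedAddCommGroup F] [NormedSpace ℝ F] [FiniteDimensional ℝ F]
      [ChartedSpace F X] [IsManifold 𝓘(ℝ, F) ∞ X] [ParacompactSpace X],
      ContMDiff (𝓘(ℝ, E).prod 𝓘(ℝ, F)) 𝓘(ℝ, F) ∞ (fun p : G × X => p.1 • p.2) →
      ProperSMul G X →
      QuasiCompleteSpace ℝ V →
      ∀ r : ℕ, 1 ≤ r →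
        Subsingleton (ContCohomology.H G (ContCohomology.MapModule G X V) r)) := by
  refine ⟨fun hV _ _ => hV.subsingleton_H, ?_⟩
  intro E _ _ _ _ _ F _ _ _ _ _ _ _ _ _
  have : LocallyConnectedSpace X := ChartedSpace.locallyConnectedSpace F X
  -- The orbit space is Hausdorff because the action is proper.
  have : ParacompactSpace (MulAction.orbitRel.Quotient G X) := paracompactSpace_orbit_quotient G X
  exact (ContCohomology.vanishLocally_of_properSMul (G := G) (X := X) (V := V)).subsingleton_H
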